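/- Let $\Gamma$ be a weighted digraph without loops on a finite vertex set $V(\Gamma)=\{1,\dots,n\}$, with arc weights $\varepsilon_{ij}\ge 0$, where $\varepsilon_{ij}>0$ if there is an arc from $i$ to $j$ and $\varepsilon_{ij}=0$ otherwise. The Kirchhoff matrix $L=(\ell_{ij})$ of $\Gamma$ is defined by $\ell_{ij}=-\varepsilon_{ji}$ for $j\ne i$ and $\ell_{ii}=-\sum_{k\ne i}\ell_{ik}$. A spanning diverging forest of $\Gamma$ is a spanning subgraph without (directed) circuits in which every vertex has indegree at most $1$; its roots are its vertices of indegree $0$. A maximum out forest is a spanning diverging forest with the maximum possible number of arcs. The forest dimension $v$ of $\Gamma$ is the number of roots of any maximum out forest (so that maximum out forests have $n-v$ arcs). The weight of a subgraph is the product of the weights of its arcs (equal to $1$ if there are none), and the weight $\varepsilon(\mathcal G)$ of a set $\mathcal G$ of subgraphs is the sum of the weights of its elements. Let $\mathcal F_{n-v}$ be the set of all maximum out forests, and let $\mathcal F^{j\to i}_{n-v}$ be the set of those in which $j$ is a root and $i$ is reachable from $j$. The normalized matrix of maximum out forests is $\bar J=(\bar J_{ij})$, $\bar J_{ij}=\varepsilon(\mathcal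 F^{j\to i}_{n-v})/\varepsilon(\mathcal F_{n-v})$. An undominated knot of $\Gamma$ is a nonempty set $K\subseteq V(\Gamma)$ of mutually reachable vertices such that no arc goes from a vertex outside $K$ to a vertex of $K$. Then $v\le n$, $\operatorname{rank} L=n-v$ and $\operatorname{rank}\bar J=v$; moreover, $v$ is equal to the number of undominated knots of $\Gamma$. -/

import Mathlib

/-- A weighted digraph without loops on the vertex set `V`, given by its matrix of arc weights:
`weight i j` is the (strictly positive) weight of the arc from `i` to `j`,
and it is zero if and only if there is no such arc. -/
structure WeightedDigraph (V : Type*) where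
  weight : V → V → ℝ
  weight_nonneg : ∀ i j, 0 ≤ weight i j
  weight_self : ∀ i, weight i i = 0

/-- The vertex `w` is reachable from `z` in the digraph with arc set `A`
(trivially if `w = z`, or else along a route of arcs directed from `z` to `w`). -/
def ArcReachable {V : Type*} (A : Finset (V × V)) (z w : V) : Prop :=
  Relation.ReflTransGen (fun a b => (a, b) ∈ A) z w

/-- The indegree of `w` in the digraph with arc set `A`. -/
def arcIndegree {V : Type*} [DecidableEq V] (A : Finset (V × V)) (w : V) : ℕ :=
  (A.filter (fun a => a.2 = w)).card

/-- The digraph with vertex set `V` and arc set `A` is a diverging forest: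
it has no circuits (no closed routes of positive length), and all indegrees are at most one. -/
def IsDivergingForest {V : Type*} [DecidableEq V] (A : Finset (V × V)) : Prop :=
  (∀ w, ¬ Relation.TransGen (fun a b => (a, b) ∈ A) w w) ∧ ∀ w, arcIndegree A w ≤ 1

/-- The roots (vertices of indegree zero) of the digraph with vertex set `V` and arc set `A`. -/
def arcRoots {V : Type*} [Fintype V] [DecidableEq V] (A : Finset (V × V)) : Finset V :=
  Finset.univ.filter (fun w => arcIndegree A w = 0)

namespace WeightedDigraph

noncomputable section

variable {V : Type*} [Fintype V] [DecidableEq V] (G : WeightedDigraph V)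

open Classical in
/-- The set of arcs. -/
def arcs : Finset (V × V) :=
  Finset.univ.filter (fun a => G.weight a.1 a.2 ≠ 0)

/-- The Kirchhoff matrix: `L i j = - weight j i` for `j ≠ i`, and all row sums are zero. -/
def kirchhoff : Matrix V V ℝ :=
  Matrix.of fun i j =>
    if j = i then ∑ k ∈ Finset.univ.erase i, G.weight k i else - G.weight j i

/-- A nonempty set of mutually reachable vertices that no arc enters from outside. -/
def IsUndominatedKnot (K : Set V) : Prop :=
  K.Nonempty ∧ (∀ i ∈ K, ∀ j ∈ K, ArcReachable G.arcs i j) ∧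
    ∀ j ∉ K, ∀ i ∈ K, (j, i) ∉ G.arcs

open Classical in
/-- The spanning diverging forests of `G`, each one given by its arc set. -/
def forests : Finset (Finset (V × V)) :=
  G.arcs.powerset.filter IsDivergingForest

/-- A spanning diverging forest with the maximum possible number of arcs. -/
def IsMaximumOutForest (F : Finset (V × V)) : Prop :=
  F ∈ G.forests ∧ ∀ F' ∈ G.forests, F'.card ≤ F.card

/-- The forest dimension: the number of roots of a maximum out forest. All maximum out forests
have the same number of roots, see `forestDim_eq`. -/
def forestDim : ℕ :=
  sInf {r | ∃ F, G.IsMaximumOutForest F ∧ (arcRoots F).card = r}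

/-- The weight of a spanning subgraph: the product of the weights of its arcs. -/
def subgraphWeight (F : Finset (V × V)) : ℝ :=
  ∏ a ∈ F, G.weight a.1 a.2

/-- The total weight of a set of spanning subgraphs. -/
def setWeight (S : Finset (Finset (V × V))) : ℝ :=
  ∑ F ∈ S, G.subgraphWeight F

/-- The spanning diverging forests with `k` arcs. -/
def forestsOfCard (k : ℕ) : Finset (Finset (V × V)) :=
  G.forests.filter (fun F => F.card = k)

open Classical in
/-- The spanning diverging forests with `k` arcs in which `j` belongs to a tree diverging
from the root `i`. -/
def forestsFromTo (k : ℕ) (i j : V) : Finset (Finset (V × V)) :=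
  (G.forestsOfCard k).filter (fun F => i ∈ arcRoots F ∧ ArcReachable F i j)

/-- The matrix `Q k` of spanning diverging forests with `k` arcs: the entry `(i, j)` is the weight
of the set of those forests in which `i` belongs to a tree diverging from `j`. -/
def forestMatrix (k : ℕ) : Matrix V V ℝ :=
  Matrix.of fun i j => G.setWeight (G.forestsFromTo k j i)

/-- The normalized matrix of maximum out forests (a maximum out forest has `n - v` arcs, where
`n` is the number of vertices and `v` the forest dimension). -/
def normalizedMaxForestMatrix : Matrix V V ℝ :=
  (G.setWeight (G.forestsOfCard (Fintype.card V - G.forestDim)))⁻¹ •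
    G.forestMatrix (Fintype.card V - G.forestDim)

/-- In a diverging forest, the number of roots and the number of arcs add up to the number
of vertices. -/
theorem card_roots_add_card {F : Finset (V × V)} (hF : IsDivergingForest F) :
    (arcRoots F).card + F.card = Fintype.card V := by
  have h1 : F.card = ∑ w : V, arcIndegree F w :=
    Finset.card_eq_sum_card_fiberwise (fun a _ => Finset.mem_coe.2 (Finset.mem_univ a.2))
  have h2 : (arcRoots F).card = ∑ w : V, if arcIndegree F w = 0 then 1 else 0 := by
    rw [arcRoots, Finset.card_filter]
  rw [h1, h2, ← Finset.sum_add_distrib, ← Finset.card_univ, Finset.card_eq_sum_ones]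
  refine Finset.sum_congr rfl fun w _ => ?_
  have := hF.2 w
  split_ifs <;> omega

open Classical in
theorem exists_isMaximumOutForest : ∃ F, G.IsMaximumOutForest F := by
  have hne : G.forests.Nonempty := by
    refine ⟨∅, ?_⟩
    rw [forests, Finset.mem_filter]
    refine ⟨Finset.empty_mem_powerset _, fun w hw => ?_, fun w => by simp [arcIndegree]⟩
    obtain ⟨b, -, hb⟩ := Relation.TransGen.tail'_iff.1 hw
    simp at hb
  obtain ⟨F, hF, hmax⟩ := Finset.exists_max_image G.forests Finset.card hne
  exact ⟨F, hF, hmax⟩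

open Classical in
/-- Every maximum out forest has exactly `forestDim` roots. -/
theorem forestDim_eq {F : Finset (V × V)} (hF : G.IsMaximumOutForest F) :
    G.forestDim = (arcRoots F).card := by
  have key : {r | ∃ F, G.IsMaximumOutForest F ∧ (arcRoots F).card = r} =
      {(arcRoots F).card} := by
    ext r
    simp only [Set.mem_ofPred_eq, Set.mem_singleton_iff]
    refine ⟨?_, fun h => ⟨F, hF, h.symm⟩⟩
    rintro ⟨F', hF', rfl⟩
    have e : F'.card = F.card := le_antisymm (hF.2 _ hF'.1) (hF'.2 _ hF.1)
    have a := card_roots_add_card (Finset.mem_filter.1 hF.1).2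
    have b := card_roots_add_card (Finset.mem_filter.1 hF'.1).2
    omega
  rw [forestDim, key, csInf_singleton]

end

end WeightedDigraph

/-! All three quantities are compared with the number of undominated knots. Every vertex is
reachable from some knot. A forest needs a root in each knot, since no arc enters it, and a forest
rooted at one representative per knot exists; hence `forestDim_eq_card_knot`, and a maximum out
forest has exactly one root in each knot and none elsewhere.

For the forest matrix, two maximum out forests can trade the arcs with heads in a knot. This gives
`Knot.forestMatrix_mul_comm`: columns belonging to one knot are proportional. The matrix therefore
factors through the space of functions on knots, and its rows at the representatives show that the
rank is no smaller.

For `L`, the maximum principle shows that a null vector is determined by its values at the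
representatives, so the nullity is at most the number of knots. Conversely, each knot carries a left
null vector, and disjoint supports make these independent. -/

theorem ArcReachable.mono {V : Type*} {A B : Finset (V × V)} (h : A ⊆ B) {z w : V}
    (hr : ArcReachable A z w) : ArcReachable B z w :=
  Relation.ReflTransGen.mono (fun _ _ hab => h hab) _ _ hr

/-! ### Roots of diverging forests -/

section DivergingForest

variable {V : Type*} [DecidableEq V] {F : Finset (V × V)}

theorem arcIndegree_eq_zero_iff {w : V} : arcIndegree F w = 0 ↔ ∀ z, (z, w) ∉ F := by
  simp only [arcIndegree, Finset.card_eq_zero, Finset.filter_eq_empty_iff]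
  exact ⟨fun h z hz => h hz rfl, fun h a ha haw => h a.1 (by rwa [← haw])⟩

theorem IsDivergingForest.eq_of_mem (hF : IsDivergingForest F) {a b w : V} (ha : (a, w) ∈ F)
    (hb : (b, w) ∈ F) : a = b := by
  have h := Finset.card_le_one.1 (hF.2 w) (a, w) (by simp [ha]) (b, w) (by simp [hb])
  exact congrArg Prod.fst h

variable [Fintype V]

theorem mem_arcRoots {w : V} : w ∈ arcRoots F ↔ ∀ z, (z, w) ∉ F := by
  simp [arcRoots, arcIndegree_eq_zero_iff]

theorem IsDivergingForest.exists_root (hF : IsDivergingForest F) (i : V) :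
    ∃ j ∈ arcRoots F, ArcReachable F j i := by
  have : IsTrans V (Relation.TransGen fun a b => (a, b) ∈ F) := ⟨fun _ _ _ => .trans⟩
  have : Std.Irrefl (Relation.TransGen fun a b => (a, b) ∈ F) := ⟨hF.1⟩
  have wf := Finite.wellFounded_of_trans_of_irrefl (Relation.TransGen fun a b => (a, b) ∈ F)
  induction i using wf.induction with
  | _ i ih =>
    by_cases hi : i ∈ arcRoots F
    · exact ⟨i, hi, .refl⟩
    · rw [mem_arcRoots] at hi
      push Not at hi
      obtain ⟨z, hz⟩ := hi
      obtain ⟨j, hj, hji⟩ := ih z (.single hz)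
      exact ⟨j, hj, hji.tail hz⟩

theorem IsDivergingForest.root_unique (hF : IsDivergingForest F) {i j k : V}
    (hj : j ∈ arcRoots F) (hk : k ∈ arcRoots F) (hji : ArcReachable F j i)
    (hki : ArcReachable F k i) : j = k := by
  induction hji with
  | refl =>
    rcases Relation.ReflTransGen.cases_tail hki with h | ⟨c, -, hc⟩
    · exact h
    · exact absurd hc (mem_arcRoots.1 hj c)
  | tail _ hbc ih =>
    rcases Relation.ReflTransGen.cases_tail hki with h | ⟨c, hkc, hc⟩
    · subst h
      exact absurd hbc (mem_arcRoots.1 hk _)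
    · exact ih (hF.eq_of_mem hc hbc ▸ hkc)

end DivergingForest

/-! ### Undominated knots and the forest dimension -/

namespace WeightedDigraph

noncomputable section

variable {V : Type*} [Fintype V] (G : WeightedDigraph V)

theorem mem_arcs {a b : V} : (a, b) ∈ G.arcs ↔ G.weight a b ≠ 0 := by
  simp [arcs]

variable {G}

theorem IsUndominatedKnot.mem_of_reachable {K : Set V} (hK : G.IsUndominatedKnot K) {x y : V}
    (hx : x ∈ K) (h : ArcReachable G.arcs y x) : y ∈ K := by
  induction h using Relation.ReflTransGen.head_induction_on with
  | refl => exact hx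
  | head hac _ ih => exact by_contra fun ha => hK.2.2 _ ha _ ih hac

theorem IsUndominatedKnot.eq_of_mem {K K' : Set V} (hK : G.IsUndominatedKnot K)
    (hK' : G.IsUndominatedKnot K') {x : V} (hx : x ∈ K) (hx' : x ∈ K') : K = K' :=
  Set.Subset.antisymm (fun y hy => hK'.mem_of_reachable hx' (hK.2.1 y hy x hx))
    fun y hy => hK.mem_of_reachable hx (hK'.2.1 y hy x hx')

/-- Among the ancestors of `w`, take one whose own set of ancestors is smallest. Each of its
ancestors has the same ancestor set, so that set is a knot. -/
theorem exists_knot_reaching (w : V) :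
    ∃ K, G.IsUndominatedKnot K ∧ ∀ x ∈ K, ArcReachable G.arcs x w := by
  classical
  let anc : V → Finset V := fun x => Finset.univ.filter fun y => ArcReachable G.arcs y x
  have mem_anc : ∀ {x y}, y ∈ anc x ↔ ArcReachable G.arcs y x := by simp [anc]
  obtain ⟨x, hx, hmin⟩ := Finset.exists_min_image (anc w) (fun x => (anc x).card)
    ⟨w, mem_anc.2 .refl⟩
  rw [mem_anc] at hx
  have hback : ∀ y, ArcReachable G.arcs y x → ArcReachable G.arcs x y := by
    intro y hy
    have hsub : anc y ⊆ anc x := fun z hz => mem_anc.2 ((mem_anc.1 hz).trans hy)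
    have heq := Finset.eq_of_subset_of_card_le hsub (hmin y (mem_anc.2 (hy.trans hx)))
    exact mem_anc.1 (heq ▸ mem_anc.2 .refl)
  refine ⟨{y | ArcReachable G.arcs y x}, ⟨⟨x, .refl⟩, fun i hi j hj => hi.trans (hback j hj),
    fun j hj i hi hji => hj (Relation.ReflTransGen.head hji hi)⟩, fun y hy => hy.trans hx⟩

variable (G) in
/-- The undominated knots of `G`. -/
abbrev Knot : Type _ := {K : Set V // G.IsUndominatedKnot K}

instance : Fintype G.Knot := Fintype.ofFinite _

/-- A chosen vertex of an undominated knot. -/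
def Knot.rep (K : G.Knot) : V := K.2.1.some

theorem Knot.rep_mem (K : G.Knot) : K.rep ∈ K.1 := K.2.1.some_mem

theorem Knot.eq_of_mem {K K' : G.Knot} {x : V} (hx : x ∈ K.1) (hx' : x ∈ K'.1) : K = K' :=
  Subtype.ext (K.2.eq_of_mem K'.2 hx hx')

theorem Knot.exists_rep_reaching (w : V) : ∃ K : G.Knot, ArcReachable G.arcs K.rep w := by
  obtain ⟨K, hK, h⟩ := G.exists_knot_reaching w
  exact ⟨⟨K, hK⟩, h _ (Knot.rep_mem ⟨K, hK⟩)⟩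

variable [DecidableEq V]

theorem subset_arcs_of_mem_forests {F : Finset (V × V)} (hF : F ∈ G.forests) : F ⊆ G.arcs := by
  classical exact Finset.mem_powerset.1 (Finset.mem_filter.1 hF).1

theorem isDivergingForest_of_mem_forests {F : Finset (V × V)} (hF : F ∈ G.forests) :
    IsDivergingForest F := by
  classical exact (Finset.mem_filter.1 hF).2

/-- A diverging forest has a root in every undominated knot. -/
theorem IsUndominatedKnot.exists_root {K : Set V} (hK : G.IsUndominatedKnot K)
    {F : Finset (V × V)} (hF : F ∈ G.forests) : ∃ j ∈ K, j ∈ arcRoots F := by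
  obtain ⟨i, hi⟩ := hK.1
  obtain ⟨j, hj, hji⟩ := (isDivergingForest_of_mem_forests hF).exists_root i
  exact ⟨j, hK.mem_of_reachable hi (hji.mono (subset_arcs_of_mem_forests hF)), hj⟩

/-- If every vertex is reachable from the set `R`, there is a spanning diverging forest all of
whose roots lie in `R`. -/
theorem exists_forest_roots_subset (R : Finset V)
    (hR : ∀ w, ∃ r ∈ R, ArcReachable G.arcs r w) : ∃ F ∈ G.forests, arcRoots F ⊆ R := by
  classical
  have hlen : ∀ w, ∃ n, ∃ r ∈ R, ∃ p : ℕ → V, p 0 = r ∧ p n = w ∧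
      ∀ k < n, (p k, p (k + 1)) ∈ G.arcs := by
    intro w
    obtain ⟨r, hr, hrw⟩ := hR w
    induction hrw with
    | refl => exact ⟨0, r, hr, fun _ => r, rfl, rfl, by simp⟩
    | @tail b c _ hbc ih =>
      obtain ⟨n, r, hr, p, h0, hn, hp⟩ := ih
      refine ⟨n + 1, r, hr, fun k => if k ≤ n then p k else c, by simp [h0], by simp, ?_⟩
      intro k hk
      rcases Nat.lt_succ_iff_lt_or_eq.1 hk with h | rfl
      · simpa [h.le, Nat.succ_le_of_lt h] using hp k h
      · simpa [hn] using hbc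
  -- `d w` is the distance from `R` to `w`. Taking as only in-arc of each vertex outside `R` one
  -- from a strictly closer vertex rules out circuits.
  let d : V → ℕ := fun w => Nat.find (hlen w)
  have hpred : ∀ w, w ∉ R → ∃ z, (z, w) ∈ G.arcs ∧ d z < d w := by
    intro w hw
    obtain ⟨r, hr, p, h0, hn, hp⟩ := Nat.find_spec (hlen w)
    change p (d w) = w at hn
    change ∀ k < d w, _ at hp
    rcases hd : d w with _ | n
    · rw [hd, h0] at hn
      exact absurd (hn ▸ hr) hw
    · rw [hd] at hn hp
      exact ⟨p n, hn ▸ hp n n.lt_succ_self, Nat.lt_succ_of_le <|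
        Nat.find_min' (hlen (p n)) ⟨r, hr, p, h0, rfl, fun k hk => hp k (hk.trans n.lt_succ_self)⟩⟩
  choose! pre hpre hlt using hpred
  let F : Finset (V × V) := (Finset.univ.filter (· ∉ R)).image fun w => (pre w, w)
  have memF : ∀ a b, (a, b) ∈ F ↔ b ∉ R ∧ a = pre b := by
    intro a b
    simp only [F, Finset.mem_image, Finset.mem_filter, Finset.mem_univ, true_and, Prod.mk.injEq]
    constructor
    · rintro ⟨w, hw, rfl, rfl⟩
      exact ⟨hw, rfl⟩
    · rintro ⟨hb, rfl⟩
      exact ⟨b, hb, rfl, rfl⟩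
  have hinc : ∀ a b, Relation.TransGen (fun a b => (a, b) ∈ F) a b → d a < d b := by
    intro a b h
    induction h with
    | single h => obtain ⟨hb, rfl⟩ := (memF _ _).1 h; exact hlt _ hb
    | tail _ h ih => obtain ⟨hb, rfl⟩ := (memF _ _).1 h; exact ih.trans (hlt _ hb)
  refine ⟨F, ?_, ?_⟩
  · rw [forests, Finset.mem_filter, Finset.mem_powerset]
    refine ⟨?_, fun w hw => (hinc w w hw).false, fun w => ?_⟩
    · rintro ⟨a, b⟩ h
      obtain ⟨hb, rfl⟩ := (memF _ _).1 h
      exact hpre b hb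
    · refine Finset.card_le_one.2 ?_
      rintro ⟨a, b⟩ h ⟨a', b'⟩ h'
      simp only [Finset.mem_filter, memF] at h h'
      obtain ⟨⟨_, rfl⟩, rfl⟩ := h
      obtain ⟨⟨_, rfl⟩, rfl⟩ := h'
      rfl
  · intro w hw
    by_contra h
    exact mem_arcRoots.1 hw (pre w) ((memF _ _).2 ⟨h, rfl⟩)

/-- A choice of a root in every undominated knot. -/
theorem exists_injective_root {F : Finset (V × V)} (hF : F ∈ G.forests) :
    ∃ f : G.Knot → arcRoots F, Function.Injective f ∧ ∀ K, (f K : V) ∈ K.1 := by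
  choose f hf hroot using fun K : G.Knot => K.2.exists_root hF
  refine ⟨fun K => ⟨f K, hroot K⟩, fun K K' h => ?_, hf⟩
  exact Knot.eq_of_mem (hf K) (by rw [show f K = f K' from congrArg Subtype.val h]; exact hf K')

variable (G) in
theorem forestDim_eq_card_knot : G.forestDim = Fintype.card G.Knot := by
  classical
  obtain ⟨F, hF⟩ := G.exists_isMaximumOutForest
  rw [G.forestDim_eq hF]
  refine le_antisymm ?_ ?_
  · obtain ⟨F', hF', hsub⟩ := G.exists_forest_roots_subset
      (Finset.univ.image (Knot.rep (G := G))) fun w => by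
        obtain ⟨K, hK⟩ := Knot.exists_rep_reaching (G := G) w
        exact ⟨K.rep, Finset.mem_image_of_mem _ (Finset.mem_univ K), hK⟩
    have h1 := (Finset.card_le_card hsub).trans Finset.card_image_le
    rw [Finset.card_univ] at h1
    have h2 := card_roots_add_card (isDivergingForest_of_mem_forests hF.1)
    have h3 := card_roots_add_card (isDivergingForest_of_mem_forests hF')
    have h4 := hF.2 F' hF'
    omega
  · obtain ⟨f, hf, -⟩ := exists_injective_root hF.1
    simpa using Fintype.card_le_of_injective f hf

variable (G) in
theorem forestDim_le_card : G.forestDim ≤ Fintype.card V := by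
  obtain ⟨F, hF⟩ := G.exists_isMaximumOutForest
  rw [G.forestDim_eq hF]
  exact Finset.card_le_univ _

theorem mem_forestsOfCard {F : Finset (V × V)} :
    F ∈ G.forestsOfCard (Fintype.card V - G.forestDim) ↔ G.IsMaximumOutForest F := by
  obtain ⟨F₀, hF₀⟩ := G.exists_isMaximumOutForest
  have h₀ := card_roots_add_card (isDivergingForest_of_mem_forests hF₀.1)
  rw [← G.forestDim_eq hF₀] at h₀
  rw [forestsOfCard, Finset.mem_filter, IsMaximumOutForest]
  refine and_congr_right fun hF => ⟨fun h F' hF' => ?_, fun h => ?_⟩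
  · have := hF₀.2 F' hF'
    omega
  · have := hF₀.2 F hF
    have := h F₀ hF₀.1
    omega

theorem mem_forestsFromTo {F : Finset (V × V)} {i j : V} :
    F ∈ G.forestsFromTo (Fintype.card V - G.forestDim) i j ↔
      G.IsMaximumOutForest F ∧ i ∈ arcRoots F ∧ ArcReachable F i j := by
  classical rw [forestsFromTo, Finset.mem_filter, mem_forestsOfCard]

namespace IsMaximumOutForest

variable {F : Finset (V × V)}

/-- The injection from knots to roots is a bijection, both sides having `forestDim` elements. -/
theorem exists_knot (hF : G.IsMaximumOutForest F) {j : V} (hj : j ∈ arcRoots F) :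
    ∃ K : G.Knot, j ∈ K.1 := by
  obtain ⟨f, hf, hmem⟩ := exists_injective_root hF.1
  have hcard : Fintype.card G.Knot = Fintype.card (arcRoots F) := by
    rw [← forestDim_eq_card_knot, G.forestDim_eq hF, Fintype.card_coe]
  obtain ⟨K, hK⟩ := ((Fintype.bijective_iff_injective_and_card f).2 ⟨hf, hcard⟩).2 ⟨j, hj⟩
  exact ⟨K, by simpa [hK] using hmem K⟩

theorem root_unique_of_mem_knot (hF : G.IsMaximumOutForest F) {K : G.Knot} {j k : V}
    (hj : j ∈ arcRoots F) (hk : k ∈ arcRoots F) (hjK : j ∈ K.1) (hkK : k ∈ K.1) : j = k := by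
  obtain ⟨f, hf, hmem⟩ := exists_injective_root hF.1
  have hcard : Fintype.card G.Knot = Fintype.card (arcRoots F) := by
    rw [← forestDim_eq_card_knot, G.forestDim_eq hF, Fintype.card_coe]
  have hsurj := ((Fintype.bijective_iff_injective_and_card f).2 ⟨hf, hcard⟩).2
  have key : ∀ x (hx : x ∈ arcRoots F), x ∈ K.1 → x = f K := by
    intro x hx hxK
    obtain ⟨K', hK'⟩ := hsurj ⟨x, hx⟩
    have : K' = K := Knot.eq_of_mem (x := x) (by simpa [hK'] using hmem K') hxK
    rw [← this, hK']
  rw [key j hj hjK, key k hk hkK]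

end IsMaximumOutForest

end

end WeightedDigraph

/-! ### Exchanging arcs inside a knot -/

namespace WeightedDigraph

noncomputable section

variable {V : Type*} [DecidableEq V]

open Classical in
/-- The arc set that has the arcs of `F'` with heads in `K` and the other arcs of `F`. -/
def exchange (K : Set V) (F F' : Finset (V × V)) : Finset (V × V) :=
  F.filter (fun a => a.2 ∉ K) ∪ F'.filter (fun a => a.2 ∈ K)

section Exchange

variable {K : Set V} {F F' : Finset (V × V)}

theorem mem_exchange_of_mem {a b : V} (hb : b ∈ K) : (a, b) ∈ exchange K F F' ↔ (a, b) ∈ F' := by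
  simp [exchange, hb]

theorem mem_exchange_of_notMem {a b : V} (hb : b ∉ K) :
    (a, b) ∈ exchange K F F' ↔ (a, b) ∈ F := by
  simp [exchange, hb]

theorem exchange_exchange : exchange K (exchange K F F') (exchange K F' F) = F := by
  ext ⟨a, b⟩
  by_cases hb : b ∈ K
  · rw [mem_exchange_of_mem hb, mem_exchange_of_mem hb]
  · rw [mem_exchange_of_notMem hb, mem_exchange_of_notMem hb]

theorem prod_exchange_mul_prod_exchange {M : Type*} [CommMonoid M] (f : V × V → M) :
    (∏ a ∈ exchange K F F', f a) * ∏ a ∈ exchange K F' F, f a =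
      (∏ a ∈ F, f a) * ∏ a ∈ F', f a := by
  classical
  have key : ∀ A B : Finset (V × V), ∏ a ∈ exchange K A B, f a =
      (∏ a ∈ A with a.2 ∉ K, f a) * ∏ a ∈ B with a.2 ∈ K, f a := by
    intro A B
    rw [exchange, Finset.prod_union]
    rw [Finset.disjoint_left]
    intro a ha hb
    exact (Finset.mem_filter.1 ha).2 (Finset.mem_filter.1 hb).2
  rw [key, key, ← Finset.prod_filter_mul_prod_filter_not F (fun a => a.2 ∈ K),
    ← Finset.prod_filter_mul_prod_filter_not F' (fun a => a.2 ∈ K)]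
  simp only [mul_left_comm, mul_comm]

theorem card_exchange_add_card_exchange :
    (exchange K F F').card + (exchange K F' F).card = F.card + F'.card := by
  -- Cardinality is a product in which every arc contributes the generator of `Multiplicative ℕ`.
  have h := prod_exchange_mul_prod_exchange (K := K) (F := F) (F' := F')
    (fun _ => Multiplicative.ofAdd 1)
  simpa [← ofAdd_nsmul, ← ofAdd_add] using h

variable [Fintype V] {G : WeightedDigraph V}

/-- No arc enters `K`, so a circuit of the exchange lies wholly inside `K`, where its arcs come from
`F'`, or wholly outside, where they come from `F`. -/
theorem IsUndominatedKnot.exchange_mem_forests (hK : G.IsUndominatedKnot K)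
    (hF : F ∈ G.forests) (hF' : F' ∈ G.forests) : exchange K F F' ∈ G.forests := by
  classical
  have hsub : exchange K F F' ⊆ G.arcs := by
    rintro ⟨a, b⟩ h
    by_cases hb : b ∈ K
    · exact subset_arcs_of_mem_forests hF' ((mem_exchange_of_mem hb).1 h)
    · exact subset_arcs_of_mem_forests hF ((mem_exchange_of_notMem hb).1 h)
  have hfor := isDivergingForest_of_mem_forests hF
  have hfor' := isDivergingForest_of_mem_forests hF'
  rw [forests, Finset.mem_filter, Finset.mem_powerset]
  refine ⟨hsub, fun w hw => ?_, fun w => ?_⟩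
  · by_cases hwK : w ∈ K
    · refine hfor'.1 w ?_
      have key : ∀ z, Relation.TransGen (fun a b => (a, b) ∈ exchange K F F') z w →
          z ∈ K ∧ Relation.TransGen (fun a b => (a, b) ∈ F') z w := by
        intro z hz
        induction hz using Relation.TransGen.head_induction_on with
        | single h =>
          exact ⟨by_contra fun hn => hK.2.2 _ hn _ hwK (hsub h),
            .single ((mem_exchange_of_mem hwK).1 h)⟩
        | head h _ ih =>
          exact ⟨by_contra fun hn => hK.2.2 _ hn _ ih.1 (hsub h),
            .head ((mem_exchange_of_mem ih.1).1 h) ih.2⟩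
      exact (key w hw).2
    · refine hfor.1 w ?_
      have key : ∀ z, Relation.TransGen (fun a b => (a, b) ∈ exchange K F F') w z →
          z ∉ K ∧ Relation.TransGen (fun a b => (a, b) ∈ F) w z := by
        intro z hz
        induction hz with
        | single h =>
          have hn := fun hz => hK.2.2 _ hwK _ hz (hsub h)
          exact ⟨hn, .single ((mem_exchange_of_notMem hn).1 h)⟩
        | tail _ h ih =>
          have hn := fun hz => hK.2.2 _ ih.1 _ hz (hsub h)
          exact ⟨hn, .tail ih.2 ((mem_exchange_of_notMem hn).1 h)⟩
      exact (key w hw).2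
  · refine Finset.card_le_one.2 ?_
    rintro ⟨a, b⟩ h ⟨a', b'⟩ h'
    rw [Finset.mem_filter] at h h'
    obtain ⟨h, rfl⟩ := h
    obtain ⟨h', rfl⟩ := h'
    by_cases hb : b' ∈ K
    · rw [hfor'.eq_of_mem ((mem_exchange_of_mem hb).1 h) ((mem_exchange_of_mem hb).1 h')]
    · rw [hfor.eq_of_mem ((mem_exchange_of_notMem hb).1 h) ((mem_exchange_of_notMem hb).1 h')]

/-- The two exchanges have the same total number of arcs as the two maximum forests, so neither can
fall short. -/
theorem IsUndominatedKnot.isMaximumOutForest_exchange (hK : G.IsUndominatedKnot K)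
    (hF : G.IsMaximumOutForest F) (hF' : G.IsMaximumOutForest F') :
    G.IsMaximumOutForest (exchange K F F') := by
  refine ⟨hK.exchange_mem_forests hF.1 hF'.1, fun A hA => ?_⟩
  have h1 := card_exchange_add_card_exchange (K := K) (F := F) (F' := F')
  have h2 := hF.2 _ (hK.exchange_mem_forests hF'.1 hF.1)
  have h3 := hF'.2 A hA
  omega

end Exchange

/-! ### Rank of the matrix of maximum out forests -/

variable [Fintype V] {G : WeightedDigraph V}

/-- Exchanging the arcs with heads in a knot between two maximum out forests exchanges the roots in
this knot, and leaves unchanged the set of vertices that are reachable from the root in it. -/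
theorem Knot.exchange_mem_forestsFromTo (K : G.Knot) {i j i' j' : V} (hj : j ∈ K.1)
    (hj' : j' ∈ K.1) {F F' : Finset (V × V)}
    (hF : F ∈ G.forestsFromTo (Fintype.card V - G.forestDim) j i)
    (hF' : F' ∈ G.forestsFromTo (Fintype.card V - G.forestDim) j' i') :
    exchange K.1 F F' ∈ G.forestsFromTo (Fintype.card V - G.forestDim) j' i := by
  rw [mem_forestsFromTo] at hF hF' ⊢
  obtain ⟨hF, -, hji⟩ := hF
  obtain ⟨hF', hjr', -⟩ := hF'
  have hmax := K.2.isMaximumOutForest_exchange hF hF'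
  have hroot : j' ∈ arcRoots (exchange K.1 F F') := by
    rw [mem_arcRoots] at hjr' ⊢
    intro z hz
    exact hjr' z ((mem_exchange_of_mem hj').1 hz)
  have hK : ∀ x ∈ K.1, ArcReachable (exchange K.1 F F') j' x := by
    intro x hx
    obtain ⟨t, ht, htx⟩ := (isDivergingForest_of_mem_forests hmax.1).exists_root x
    have htK := K.2.mem_of_reachable hx (htx.mono (subset_arcs_of_mem_forests hmax.1))
    rwa [← hmax.root_unique_of_mem_knot ht hroot htK hj']
  refine ⟨hmax, hroot, ?_⟩
  -- Along the route from `j` to `i` in `F`, arcs with heads outside `K` survive, and vertices of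
  -- `K` are reached from `j'` anyway.
  induction hji with
  | refl => exact hK _ hj
  | @tail b c _ hbc ih =>
    by_cases hc : c ∈ K.1
    · exact hK c hc
    · exact ih.tail ((mem_exchange_of_notMem hc).2 hbc)

/-- The exchange is a weight-preserving bijection between the pairs of forests counted on the two
sides; its inverse is again the exchange. -/
theorem Knot.forestMatrix_mul_comm (K : G.Knot) (i i' : V) {j j' : V} (hj : j ∈ K.1)
    (hj' : j' ∈ K.1) :
    G.forestMatrix (Fintype.card V - G.forestDim) i j *
        G.forestMatrix (Fintype.card V - G.forestDim) i' j' =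
      G.forestMatrix (Fintype.card V - G.forestDim) i j' *
        G.forestMatrix (Fintype.card V - G.forestDim) i' j := by
  simp only [forestMatrix, Matrix.of_apply, setWeight, Finset.sum_mul_sum, ← Finset.sum_product']
  refine Finset.sum_nbij' (fun p => (exchange K.1 p.1 p.2, exchange K.1 p.2 p.1))
    (fun p => (exchange K.1 p.1 p.2, exchange K.1 p.2 p.1)) ?_ ?_ ?_ ?_ ?_
  · intro p hp
    rw [Finset.mem_product] at hp ⊢
    exact ⟨K.exchange_mem_forestsFromTo hj hj' hp.1 hp.2,
      K.exchange_mem_forestsFromTo hj' hj hp.2 hp.1⟩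
  · intro p hp
    rw [Finset.mem_product] at hp ⊢
    exact ⟨K.exchange_mem_forestsFromTo hj' hj hp.1 hp.2,
      K.exchange_mem_forestsFromTo hj hj' hp.2 hp.1⟩
  · intro p _
    simp only [exchange_exchange]
  · intro p _
    simp only [exchange_exchange]
  · intro p _
    exact (prod_exchange_mul_prod_exchange _).symm

variable (G) in
-- Each maximum out forest is counted once, at the unique root from which `i` is reachable.
theorem sum_forestMatrix (i : V) :
    ∑ j, G.forestMatrix (Fintype.card V - G.forestDim) i j =
      G.setWeight (G.forestsOfCard (Fintype.card V - G.forestDim)) := by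
  classical
  simp only [forestMatrix, Matrix.of_apply, setWeight, forestsFromTo, Finset.sum_filter]
  rw [Finset.sum_comm]
  refine Finset.sum_congr rfl fun F hF => ?_
  have hfor := isDivergingForest_of_mem_forests (mem_forestsOfCard.1 hF).1
  obtain ⟨j, hj, hji⟩ := hfor.exists_root i
  rw [Finset.sum_eq_single j, if_pos ⟨hj, hji⟩]
  · exact fun k _ hk => if_neg fun h => hk (hfor.root_unique h.1 hj h.2 hji)
  · exact fun h => absurd (Finset.mem_univ j) h

variable (G) in
theorem setWeight_maximumOutForests_pos :
    0 < G.setWeight (G.forestsOfCard (Fintype.card V - G.forestDim)) := by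
  obtain ⟨F, hF⟩ := G.exists_isMaximumOutForest
  refine Finset.sum_pos (fun F hF => Finset.prod_pos fun a ha => ?_) ⟨F, mem_forestsOfCard.2 hF⟩
  have := subset_arcs_of_mem_forests (mem_forestsOfCard.1 hF).1 ha
  exact lt_of_le_of_ne (G.weight_nonneg _ _) (G.mem_arcs.1 this).symm

theorem forestMatrix_eq_zero_of_forall_notMem {j : V} (hj : ∀ K : G.Knot, j ∉ K.1) (i : V) :
    G.forestMatrix (Fintype.card V - G.forestDim) i j = 0 := by
  refine Finset.sum_eq_zero fun F hF => ?_
  rw [mem_forestsFromTo] at hF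
  obtain ⟨K, hK⟩ := hF.1.exists_knot hF.2.1
  exact absurd hK (hj K)

theorem Knot.forestMatrix_eq_zero (K : G.Knot) {i j : V} (hi : i ∈ K.1) (hj : j ∉ K.1) :
    G.forestMatrix (Fintype.card V - G.forestDim) i j = 0 := by
  refine Finset.sum_eq_zero fun F hF => ?_
  rw [mem_forestsFromTo] at hF
  exact absurd (K.2.mem_of_reachable hi (hF.2.2.mono (subset_arcs_of_mem_forests hF.1.1))) hj

open Classical in
variable (G) in
/-- The indicator matrix of the undominated knots. -/
def knotIndicator : Matrix V G.Knot ℝ :=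
  Matrix.of fun j K => if j ∈ K.1 then 1 else 0

variable (G) in
-- This bounds the rank from above. For `j` in a knot `K`, expand the total weight as the row sum at
-- `K.rep`, which is supported on `K`, and swap columns in each term.
theorem setWeight_smul_forestMatrix :
    G.setWeight (G.forestsOfCard (Fintype.card V - G.forestDim)) •
        G.forestMatrix (Fintype.card V - G.forestDim) =
      G.forestMatrix (Fintype.card V - G.forestDim) * G.knotIndicator *
        (G.forestMatrix (Fintype.card V - G.forestDim)).submatrix (Knot.rep (G := G)) id := by
  classical
  ext i j
  rw [Matrix.smul_apply, smul_eq_mul, Matrix.mul_apply]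
  by_cases hj : ∃ K : G.Knot, j ∈ K.1
  · obtain ⟨K, hK⟩ := hj
    rw [Finset.sum_eq_single K, ← G.sum_forestMatrix K.rep, Matrix.mul_apply, Finset.sum_mul,
      Finset.sum_mul]
    · refine Finset.sum_congr rfl fun j' _ => ?_
      rw [Matrix.submatrix_apply, id, knotIndicator, Matrix.of_apply]
      split_ifs with h
      · rw [mul_one, mul_comm, K.forestMatrix_mul_comm i K.rep hK h]
      · rw [K.forestMatrix_eq_zero K.rep_mem h]
        simp
    · intro K' _ hne
      rw [Matrix.submatrix_apply, id, K'.forestMatrix_eq_zero K'.rep_mem, mul_zero]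
      exact fun h => hne (Knot.eq_of_mem h hK)
    · exact fun h => absurd (Finset.mem_univ K) h
  · push Not at hj
    simp [forestMatrix_eq_zero_of_forall_notMem hj]

variable (G) in
theorem forestMatrix_submatrix_mul_knotIndicator [DecidableEq G.Knot] :
    (G.forestMatrix (Fintype.card V - G.forestDim)).submatrix (Knot.rep (G := G)) id * G.knotIndicator =
      G.setWeight (G.forestsOfCard (Fintype.card V - G.forestDim)) • 1 := by
  ext K K'
  rw [Matrix.smul_apply, Matrix.mul_apply, Matrix.one_apply, ← G.sum_forestMatrix K.rep,
    Finset.sum_smul]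
  refine Finset.sum_congr rfl fun j _ => ?_
  by_cases hj : j ∈ K.1
  · have : j ∈ K'.1 ↔ K = K' := ⟨fun h => Knot.eq_of_mem hj h, fun h => h ▸ hj⟩
    simp [knotIndicator, this]
  · simp [K.forestMatrix_eq_zero K.rep_mem hj]

variable (G) in
theorem rank_normalizedMaxForestMatrix :
    G.normalizedMaxForestMatrix.rank = Fintype.card G.Knot := by
  classical
  have hσ := G.setWeight_maximumOutForests_pos.ne'
  have h1 := G.setWeight_smul_forestMatrix
  have h2 := G.forestMatrix_submatrix_mul_knotIndicator
  rw [normalizedMaxForestMatrix]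
  set σ := G.setWeight (G.forestsOfCard (Fintype.card V - G.forestDim))
  set N := G.forestMatrix (Fintype.card V - G.forestDim)
  refine le_antisymm ?_ ?_
  · have : σ⁻¹ • N = ((σ⁻¹ * σ⁻¹) • (N * G.knotIndicator)) * N.submatrix (Knot.rep (G := G)) id := by
      rw [Matrix.smul_mul, ← h1, smul_smul, mul_assoc, inv_mul_cancel₀ hσ, mul_one]
    rw [this]
    exact (Matrix.rank_mul_le_left _ _).trans (Matrix.rank_le_card_width _)
  -- The row-selected identity extracts the rows at the representatives, so the identity on knots
  -- factors through the normalized matrix.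
  · have h3 : (1 : Matrix V V ℝ).submatrix (Knot.rep (G := G)) id * (σ⁻¹ • N) *
        G.knotIndicator = 1 := by
      have : (1 : Matrix V V ℝ).submatrix (Knot.rep (G := G)) id * N =
          N.submatrix (Knot.rep (G := G)) id := by
        ext K j
        simp [Matrix.mul_apply, Matrix.one_apply]
      rw [Matrix.mul_smul, Matrix.smul_mul, this, h2, smul_smul, inv_mul_cancel₀ hσ, one_smul]
    rw [← Matrix.rank_one (n := G.Knot) (R := ℝ), ← h3]
    exact (Matrix.rank_mul_le_left _ _).trans (Matrix.rank_mul_le_right _ _)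

end

end WeightedDigraph

/-! ### Rank of the Kirchhoff matrix -/

namespace WeightedDigraph

noncomputable section

variable {V : Type*} [Fintype V] [DecidableEq V] (G : WeightedDigraph V)

theorem kirchhoff_mulVec (x : V → ℝ) (i : V) :
    (G.kirchhoff.mulVec x) i = ∑ k, G.weight k i * (x i - x k) := by
  rw [Matrix.mulVec, dotProduct, ← Finset.add_sum_erase _ _ (Finset.mem_univ i),
    ← Finset.add_sum_erase _ (fun k => G.weight k i * (x i - x k)) (Finset.mem_univ i), sub_self,
    mul_zero, zero_add, kirchhoff, Matrix.of_apply, if_pos rfl, Finset.sum_mul,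
    ← Finset.sum_add_distrib]
  refine Finset.sum_congr rfl fun k hk => ?_
  rw [Matrix.of_apply, if_neg (Finset.ne_of_mem_erase hk)]
  ring

variable {G}

/-- The maximum principle for the Kirchhoff matrix. -/
theorem nonpos_of_kirchhoff_mulVec_eq_zero {x : V → ℝ} (hx : G.kirchhoff.mulVec x = 0)
    (hrep : ∀ K : G.Knot, x K.rep = 0) (w : V) : x w ≤ 0 := by
  obtain ⟨i, -, hi⟩ := Finset.exists_max_image Finset.univ x ⟨w, Finset.mem_univ w⟩
  obtain ⟨K, hK⟩ := Knot.exists_rep_reaching (G := G) i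
  -- At a maximum of `x` the nonnegative terms `weight k b * (x b - x k)` sum to zero, so the
  -- maximal value spreads backwards along arcs.
  have key : ∀ y, ArcReachable G.arcs y i → x y = x i := by
    intro y hy
    induction hy using Relation.ReflTransGen.head_induction_on with
    | refl => rfl
    | @head a b hab _ ih =>
      have h0 := G.kirchhoff_mulVec x b
      rw [hx, Pi.zero_apply, eq_comm, Finset.sum_eq_zero_iff_of_nonneg] at h0
      · have := (mul_eq_zero.1 (h0 a (Finset.mem_univ a))).resolve_left (G.mem_arcs.1 hab)
        linarith
      · intro k _
        exact mul_nonneg (G.weight_nonneg _ _) (by linarith [hi k (Finset.mem_univ k)])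
  rw [← hrep K, key _ hK]
  exact hi w (Finset.mem_univ w)

theorem eq_zero_of_kirchhoff_mulVec_eq_zero {x : V → ℝ} (hx : G.kirchhoff.mulVec x = 0)
    (hrep : ∀ K : G.Knot, x K.rep = 0) : x = 0 := by
  ext w
  refine le_antisymm (nonpos_of_kirchhoff_mulVec_eq_zero hx hrep w) ?_
  have := nonpos_of_kirchhoff_mulVec_eq_zero (x := -x) (by rw [Matrix.mulVec_neg, hx, neg_zero])
    (fun K => by simp [hrep K]) w
  simpa using this

variable (G) in
theorem card_le_rank_kirchhoff_add : Fintype.card V ≤ G.kirchhoff.rank + Fintype.card G.Knot := by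
  have h1 := LinearMap.finrank_range_add_finrank_ker G.kirchhoff.mulVecLin
  rw [Module.finrank_fintype_fun_eq_card] at h1
  let f : LinearMap.ker G.kirchhoff.mulVecLin →ₗ[ℝ] G.Knot → ℝ :=
    (LinearMap.funLeft ℝ ℝ (Knot.rep (G := G))).comp (Submodule.subtype _)
  have hf : Function.Injective f := by
    rw [← LinearMap.ker_eq_bot, LinearMap.ker_eq_bot']
    rintro ⟨x, hx⟩ h
    refine Subtype.ext (eq_zero_of_kirchhoff_mulVec_eq_zero hx fun K => congrFun h K)
  have h2 := LinearMap.finrank_le_finrank_of_injective hf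
  rw [Module.finrank_fintype_fun_eq_card] at h2
  rw [Matrix.rank]
  omega

/-- Every undominated knot supports a nonzero left null vector of the Kirchhoff matrix. -/
theorem Knot.exists_vecMul_kirchhoff_eq_zero (K : G.Knot) :
    ∃ y : V → ℝ, Matrix.vecMul y G.kirchhoff = 0 ∧ (∀ j ∉ K.1, y j = 0) ∧ ∃ s ∈ K.1, y s = 1 := by
  classical
  have hzero : ∀ i ∈ K.1, ∀ j ∉ K.1, G.kirchhoff i j = 0 := by
    intro i hi j hj
    have hne : j ≠ i := fun h => hj (h ▸ hi)
    have := K.2.2.2 j hj i hi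
    rw [mem_arcs, not_not] at this
    rw [kirchhoff, Matrix.of_apply, if_neg hne, this, neg_zero]
  have hsum : ∀ (g : V → ℝ), (∀ j ∉ K.1, g j = 0) → ∑ j : K.1, g j = ∑ j, g j := by
    intro g hg
    rw [Finset.sum_set_coe (f := g)]
    exact Finset.sum_subset (Finset.subset_univ _) fun j _ hj => hg j (by simpa using hj)
  -- Rows of `L` indexed by `K` vanish outside `K`, so the principal block keeps zero row sums and
  -- kills the constant vector.
  have hdet : (G.kirchhoff.submatrix (Subtype.val : K.1 → V) Subtype.val).det = 0 := by
    rw [← Matrix.exists_mulVec_eq_zero_iff]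
    refine ⟨1, fun h => one_ne_zero (congrFun h ⟨K.rep, K.rep_mem⟩), ?_⟩
    ext i
    have h := G.kirchhoff_mulVec 1 i
    simp only [Pi.one_apply, sub_self, mul_zero, Finset.sum_const_zero] at h
    rw [Pi.zero_apply, ← h]
    simp only [Matrix.mulVec, dotProduct, Matrix.submatrix_apply, Pi.one_apply, mul_one]
    exact hsum _ (hzero i i.2)
  obtain ⟨y, hy, hyL⟩ := Matrix.exists_vecMul_eq_zero_iff.2 hdet
  obtain ⟨s, hs⟩ := Function.ne_iff.1 hy
  -- Extend the left null vector of the block by zero, scaled to equal one at `s`.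
  refine ⟨fun j => if h : j ∈ K.1 then (y s)⁻¹ * y ⟨j, h⟩ else 0, ?_, fun j hj => dif_neg hj,
    s, s.2, ?_⟩
  · ext j
    rw [Pi.zero_apply, Matrix.vecMul, dotProduct,
      ← hsum _ fun i hi => by rw [dif_neg hi, zero_mul]]
    simp only [Subtype.coe_prop, dite_true, Subtype.coe_eta]
    by_cases hj : j ∈ K.1
    · have h := congrFun hyL ⟨j, hj⟩
      simp only [Matrix.vecMul, dotProduct, Matrix.submatrix_apply, Pi.zero_apply] at h
      simp only [mul_assoc, ← Finset.mul_sum, h, mul_zero]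
    · exact Finset.sum_eq_zero fun i _ => by rw [hzero i i.2 j hj, mul_zero]
  · simpa using inv_mul_cancel₀ hs

variable (G) in
theorem card_knot_add_rank_kirchhoff_le :
    Fintype.card G.Knot + G.kirchhoff.rank ≤ Fintype.card V := by
  classical
  choose y hy hsupp s hs hone using Knot.exists_vecMul_kirchhoff_eq_zero (G := G)
  have hmul : Matrix.of y * G.kirchhoff = 0 := by
    ext K j
    exact congrFun (hy K) j
  refine le_trans (Nat.add_le_add_right ?_ _) (Matrix.rank_add_rank_le_card_of_mul_eq_zero hmul)
  -- The columns of `y` at the normalizing vertices form an identity matrix, because distinct knots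
  -- are disjoint; so `y` has full row rank.
  have hinv : Matrix.of y * (1 : Matrix V V ℝ).submatrix id s = 1 := by
    ext K K'
    rw [Matrix.mul_apply, Matrix.one_apply]
    simp only [Matrix.of_apply, Matrix.submatrix_apply, id, Matrix.one_apply, mul_ite, mul_one,
      mul_zero, Finset.sum_ite_eq', Finset.mem_univ, if_true]
    split_ifs with h
    · rw [h, hone]
    · exact hsupp K _ fun hm => h (Knot.eq_of_mem hm (hs K'))
  rw [← Matrix.rank_one (n := G.Knot) (R := ℝ), ← hinv]
  exact Matrix.rank_mul_le_left _ _

end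

end WeightedDigraph

theorem proposition12 {V : Type*} [Fintype V] [DecidableEq V] (G : WeightedDigraph V) :
    G.forestDim ≤ Fintype.card V ∧
      G.kirchhoff.rank = Fintype.card V - G.forestDim ∧
      G.normalizedMaxForestMatrix.rank = G.forestDim ∧
      G.forestDim = {K : Set V | G.IsUndominatedKnot K}.ncard := by
  have hv := G.forestDim_eq_card_knot
  refine ⟨G.forestDim_le_card, ?_, ?_, ?_⟩
  · have h1 := G.card_le_rank_kirchhoff_add
    have h2 := G.card_knot_add_rank_kirchhoff_le
    omega
  · rw [hv, G.rank_normalizedMaxForestMatrix]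
  · rw [hv, ← Nat.card_eq_fintype_card]
    rfl
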